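/- Let $\mathcal T=(\mathbb T,\mathsf V,\xi)$ be a strict topological theory: $\mathsf V=(\mathsf V,\otimes,k)$ is a commutative unital quantale; $\mathbb T=(T,e,m)$ is a monad on $\mathsf{Set}$ such that $T$ sends pullbacks to weak pullbacks and every naturality square of $m$ is a weak pullback; and $\xi:T\mathsf V\to\mathsf V$ is an Eilenberg–Moore algebra such that $\otimes$ and $k$ are $\mathbb T$-algebra homomorphisms and the monotone maps $\mathsf V^X\to\mathsf V^{TX}$, $\varphi\mapsto \xi\cdot T\varphi$, are natural from $P$ to $PT$, where $P$ is the $\mathsf V$-powerset functor ($PX=\mathsf V^X$, $Pf(\varphi)(y)=\bigvee_{f(x)=y}\varphi(x)$). For $r:X\times Y\to\mathsf V$ put $T_\xi r(\mathfrak x,\mathfrak y)=\bigvee\{\xi\cdot Tr(\mathfrak w)\mid \mathfrak w\in T(X\times Y),\ T\pi_1(\mathfrak w)=\mathfrak x,\ T\pi_2(\mathfrak w)=\mathfrak y\}$. A $\mathcal T$-relation $\alpha:X\nrightarrow Y$ is a map $TX\times Y\to\mathsf V$; these are ordered pointwise and composed by the Kleisli convolution $\beta\circ\alpha=\beta\cdot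 T_\xi\alpha\cdot m_X^\circ$, that is, $(\beta\circ\alpha)(\mathfrak x,z)=\bigvee\{T_\xi\alpha(\mathfrak X,\mathfrak y)\otimes\beta(\mathfrak y,z)\mid \mathfrak y\in TY,\ \mathfrak X\in TTX,\ m_X(\mathfrak X)=\mathfrak x\}$. A $\mathcal T$-category is a pair $(X,a)$ with $a:X\nrightarrow X$, $k\le a(e_X(x),x)$ and $a\circ a\le a$; a $\mathcal T$-functor $f:(X,a)\to(Y,b)$ is a map with $a(\mathfrak x,x)\le b(Tf(\mathfrak x),f(x))$; a $\mathcal T$-distributor $\varphi:(X,a)\to(Y,b)$ is a $\mathcal T$-relation $X\nrightarrow Y$ with $\varphi\circ a\le\varphi$ and $b\circ\varphi\le\varphi$. Each $\mathcal T$-functor $f$ induces distributors $f_*(\mathfrak x,y)=b(Tf(\mathfrak x),y)$ from $X$ to $Y$ and $f^*(\mathfrak y,x)=b(\mathfrak y,f(x))$ from $Y$ to $X$. For $f,g:X\to Y$, $f\le g$ means $f^*\le g^*$, and $f\dashv g$ (for $g:Y\to X$) means $1_X\le g\cdot f$ and $f\cdot g\le 1_Y$. Let $G=(1,e_1^\circ)$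 be the free $\mathcal T$-category on one point, with $e_1^\circ(\mathfrak u,*)=k$ if $\mathfrak u=e_1(*)$ and $\bot$ otherwise. The presheaf $\mathcal T$-category $\mathcal PX$ is the set of all $\psi:TX\to\mathsf V$ that are $\mathcal T$-distributors from $X$ to $G$, with structure $$[\![\mathfrak p,\psi]\!]=\bigwedge\{\hom(\xi\cdot T\mathrm{ev}(\mathfrak q),\psi(m_X\cdot T\pi_1(\mathfrak q)))\mid \mathfrak q\in T(TX\times\mathcal PX),\ T\pi_2(\mathfrak q)=\mathfrak p\},$$ where $\mathrm{ev}(\mathfrak x,\psi)=\psi(\mathfrak x)$ and $\hom(u,-)$ is right adjoint to $u\otimes(-)$. Let $\Phi$ be a class of $\mathcal T$-distributors such that (Ax 1) $f^*\in\Phi$ for every $\mathcal T$-functor $f$; (Ax 2) for all $\varphi\in\Phi$ and every $\mathcal T$-functor $f$, $f^*\circ\varphi\in\Phi$, $\varphi\circ f^*\in\Phi$, and $\varphi\circ f_*\in\Phi$ whenever $f_*\in\Phi$ (whenever the composites are defined); (Ax 3) a $\mathcal T$-distributor $\varphi:X\to Y$ is in $\Phi$ whenever $y^*\circ\varphi\in\Phi$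 for all $y\in Y$, where $y:G\to Y$ picks out $y$. A $\mathcal T$-functor $f$ is $\Phi$-dense if $f_*\in\Phi$. A $\mathcal T$-category $X$ is $\Phi$-cocomplete if for all $\varphi:Y\to Z$ in $\Phi$ and all $\mathcal T$-functors $h:Y\to X$ there is a $\mathcal T$-functor $g:Z\to X$ with $g_*=\mathrm{Ext}_\varphi(h_*)$, where $\mathrm{Ext}_\varphi$ is the right adjoint of $(-)\circ\varphi$, that is, $\gamma\circ\varphi\le\delta$ if and only if $\gamma\le\mathrm{Ext}_\varphi(\delta)$. Let $\Phi X=\{\psi\in\mathcal PX\mid\psi\in\Phi\}$ as a subcategory of $\mathcal PX$, and let $y_X^\Phi:X\to\Phi X$, $x\mapsto a(-,x)$, be the restricted Yoneda functor. For a $\mathcal T$-functor $f:X\to Y$ let $\Phi f:\Phi X\to\Phi Y$, $\psi\mapsto\psi\circ f^*$, and, if $f$ is $\Phi$-dense, $f^{-1}:\Phi Y\to\Phi X$, $\psi\mapsto\psi\circ f_*$. Write $\mathrm{Sup}^\Phi_X$ for a left adjoint of $y_X^\Phi$. **Proposition.** For every $\mathcal T$-category $X$: 1. $\Phi X$ is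 $\Phi$-cocomplete; 2. $y_X^\Phi$ is $\Phi$-dense, and $\mathrm{Sup}^\Phi_{\Phi X}=(y_X^\Phi)^{-1}$; that is, a $\mathcal T$-functor $S:\Phi\Phi X\to\Phi X$ is left adjoint to $y^\Phi_{\Phi X}$ if and only if $S=(y_X^\Phi)^{-1}$; moreover $(y_X^\Phi)^{-1}\cdot y^\Phi_{\Phi X}=1_{\Phi X}$; 3. consequently $\Phi y_X^\Phi\dashv (y_X^\Phi)^{-1}\dashv y_{\Phi X}^\Phi$. -/

import Mathlib

universe u

namespace TopTh

section SetMonad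

variable (M : CategoryTheory.Monad (Type u))

/-- The action `T f : T X → T Y` of the functor part of a `Set`-monad, as a plain function. -/
def fmap {X Y : Type u} (f : X → Y) : M.obj X → M.obj Y := fun t => M.map (TypeCat.ofHom f) t

/-- The unit `e_X : X → T X`, as a plain function. -/
def unit (X : Type u) : X → M.obj X := fun x => M.η.app X x

/-- The multiplication `m_X : T T X → T X`, as a plain function. -/
def mult (X : Type u) : M.obj (M.obj X) → M.obj X := fun t => M.μ.app X t

theorem fmap_id {X : Type u} (t : M.obj X) : fmap M (fun x : X => x) t = t := by
  have h := M.toFunctor.map_id X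
  exact congrArg (fun g : M.obj X ⟶ M.obj X => g t) h

theorem fmap_fmap {X Y Z : Type u} (f : X → Y) (g : Y → Z) (t : M.obj X) :
    fmap M g (fmap M f t) = fmap M (fun x => g (f x)) t := by
  have h := M.toFunctor.map_comp (TypeCat.ofHom f) (TypeCat.ofHom g)
  exact (congrArg (fun k : M.obj X ⟶ M.obj Z => k t) h).symm

theorem fmap_unit {X Y : Type u} (f : X → Y) (x : X) :
    fmap M f (unit M X x) = unit M Y (f x) := by
  have h := M.η.naturality (TypeCat.ofHom f)
  exact (congrArg (fun k : X ⟶ M.obj Y => k x) h).symm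

theorem fmap_mult {X Y : Type u} (f : X → Y) (t : M.obj (M.obj X)) :
    fmap M f (mult M X t) = mult M Y (fmap M (fmap M f) t) := by
  have h := M.μ.naturality (TypeCat.ofHom f)
  exact (congrArg (fun k : M.obj (M.obj X) ⟶ M.obj Y => k t) h).symm

theorem mult_mult {X : Type u} (t : M.obj (M.obj (M.obj X))) :
    mult M X (fmap M (mult M X) t) = mult M X (mult M (M.obj X) t) := by
  have h := M.assoc X
  exact congrArg (fun k : M.obj (M.obj (M.obj X)) ⟶ M.obj X => k t) h

theorem mult_unit {X : Type u} (t : M.obj X) : mult M X (unit M (M.obj X) t) = t := by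
  have h := M.left_unit X
  exact congrArg (fun k : M.obj X ⟶ M.obj X => k t) h

theorem mult_fmap_unit {X : Type u} (t : M.obj X) : mult M X (fmap M (unit M X) t) = t := by
  have h := M.right_unit X
  exact congrArg (fun k : M.obj X ⟶ M.obj X => k t) h

end SetMonad

/-- The map `P f : V^X → V^Y` of the `V`-powerset functor,
`P f (φ) (y) = ⋁ {φ x | f x = y}`. -/
def pushforward {V : Type u} [CompleteLattice V] {X Y : Type u} (f : X → Y) (φ : X → V) : Y → V :=
  fun y => ⨆ (x : X) (_ : f x = y), φ x

/-- A (strict) topological theory `(𝕋, V, ξ)` over the commutative unital quantale `V`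
(tensor `*`, neutral element `1`). -/
structure TopologicalTheory (V : Type u) [CommMonoid V] [CompleteLattice V] [IsQuantale V] where
  /-- The monad `(T, e, m)` on the category of sets. -/
  monad : CategoryTheory.Monad (Type u)
  /-- `T` sends pullbacks to weak pullbacks. -/
  map_weakPullback : ∀ {X Y Z : Type u} (f : X → Z) (g : Y → Z)
    (s : monad.obj X) (t : monad.obj Y), fmap monad f s = fmap monad g t →
    ∃ w : monad.obj {p : X × Y // f p.1 = g p.2},
      fmap monad (fun p => p.1.1) w = s ∧ fmap monad (fun p => p.1.2) w = t
  /-- The naturality squares of `m` are weak pullbacks. -/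
  mult_weakPullback : ∀ {X Y : Type u} (f : X → Y) (s : monad.obj X)
    (t : monad.obj (monad.obj Y)), fmap monad f s = mult monad Y t →
    ∃ w : monad.obj (monad.obj X), mult monad X w = s ∧ fmap monad (fmap monad f) w = t
  /-- The structure map `ξ : T V → V`. -/
  ξ : monad.obj V → V
  ξ_unit : ∀ v : V, ξ (unit monad V v) = v
  ξ_mult : ∀ t : monad.obj (monad.obj V), ξ (mult monad V t) = ξ (fmap monad ξ t)
  /-- The neutral element `1 → V` is an algebra homomorphism. -/
  ξ_one : ∀ t : monad.obj PUnit.{u + 1}, ξ (fmap monad (fun _ => (1 : V)) t) = 1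
  /-- The tensor `V × V → V` is an algebra homomorphism. -/
  ξ_mul : ∀ t : monad.obj (V × V),
    ξ (fmap monad (fun p => p.1 * p.2) t) = ξ (fmap monad Prod.fst t) * ξ (fmap monad Prod.snd t)
  /-- `φ ↦ ξ · T φ` is monotone. -/
  ξ_mono : ∀ {X : Type u} (φ φ' : X → V), φ ≤ φ' →
    ∀ t : monad.obj X, ξ (fmap monad φ t) ≤ ξ (fmap monad φ' t)
  /-- `φ ↦ ξ · T φ` is natural from `P` to `P T`. -/
  ξ_natural : ∀ {X Y : Type u} (f : X → Y) (φ : X → V) (t : monad.obj Y),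
    ξ (fmap monad (pushforward f φ) t)
      = pushforward (fmap monad f) (fun s => ξ (fmap monad φ s)) t

variable {V : Type u} [CommMonoid V] [CompleteLattice V] [IsQuantale V]

theorem mul_iSup_sort {ι : Sort*} (x : V) (f : ι → V) : x * ⨆ i, f i = ⨆ i, x * f i := by
  rw [iSup, mul_sSup_distrib, iSup_range]

theorem iSup_mul_sort {ι : Sort*} (f : ι → V) (x : V) : (⨆ i, f i) * x = ⨆ i, f i * x := by
  rw [iSup, sSup_mul_distrib, iSup_range]

namespace TopologicalTheory

variable (𝕋 : TopologicalTheory V)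

/-- The underlying set functor of the theory, on objects. -/
abbrev T (X : Type u) : Type u := 𝕋.monad.obj X

/-- The underlying set functor of the theory, on maps. -/
abbrev map {X Y : Type u} (f : X → Y) : 𝕋.T X → 𝕋.T Y := fmap 𝕋.monad f

/-- The unit of the monad. -/
abbrev e (X : Type u) : X → 𝕋.T X := unit 𝕋.monad X

/-- The multiplication of the monad. -/
abbrev m (X : Type u) : 𝕋.T (𝕋.T X) → 𝕋.T X := mult 𝕋.monad X

/-- The extension `T_ξ` of `T` to `V`-relations:
`T_ξ r (s, t) = ⋁ {ξ (T r (w)) | w ∈ T (X × Y), T π₁ (w) = s, T π₂ (w) = t}`. -/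
def ext {X Y : Type u} (r : X → Y → V) : 𝕋.T X → 𝕋.T Y → V :=
  fun s t => ⨆ (w : 𝕋.T (X × Y)) (_ : 𝕋.map Prod.fst w = s ∧ 𝕋.map Prod.snd w = t),
    𝕋.ξ (𝕋.map (fun p => r p.1 p.2) w)

/-- `𝕋`-relations from `X` to `Y`: `V`-relations from `T X` to `Y`, with the pointwise order. -/
abbrev TRel (X Y : Type u) : Type u := 𝕋.T X → Y → V

/-- The `V`-relation `T_ξ α · m_X°` from `T X` to `T Y`, for a `𝕋`-relation `α`. -/
def lift {X Y : Type u} (α : 𝕋.TRel X Y) : 𝕋.T X → 𝕋.T Y → V :=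
  fun s t => ⨆ (S : 𝕋.T (𝕋.T X)) (_ : 𝕋.m X S = s), 𝕋.ext α S t

/-- The Kleisli convolution `β ∘ α = β · T_ξ α · m_X°`. -/
def comp {X Y Z : Type u} (β : 𝕋.TRel Y Z) (α : 𝕋.TRel X Y) : 𝕋.TRel X Z :=
  fun s z => ⨆ t : 𝕋.T Y, 𝕋.lift α s t * β t z

open Quantale in
/-- The extension `γ ⟜ α` of `γ` along `α`: the extension in `V`-relations of `γ` along
`T_ξ α · m_X°`. It is right adjoint to `(-) ∘ α`. -/
def extension {X Y Z : Type u} (γ : 𝕋.TRel X Z) (α : 𝕋.TRel X Y) : 𝕋.TRel Y Z :=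
  fun t z => ⨅ s : 𝕋.T X, 𝕋.lift α s t ⇨ₗ γ s z

section Calculus

theorem le_ext {X Y : Type u} (r : X → Y → V) (w : 𝕋.T (X × Y)) :
    𝕋.ξ (𝕋.map (fun p => r p.1 p.2) w) ≤ 𝕋.ext r (𝕋.map Prod.fst w) (𝕋.map Prod.snd w) :=
  le_iSup₂_of_le w ⟨rfl, rfl⟩ le_rfl

theorem ext_mono {X Y : Type u} {r r' : X → Y → V} (h : r ≤ r') : 𝕋.ext r ≤ 𝕋.ext r' := by
  intro s t
  refine iSup₂_le fun w hw => le_iSup₂_of_le w hw ?_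
  exact 𝕋.ξ_mono _ _ (fun p => h p.1 p.2) w

theorem lift_mono {X Y : Type u} {r r' : 𝕋.TRel X Y} (h : r ≤ r') : 𝕋.lift r ≤ 𝕋.lift r' := by
  intro s t
  exact iSup₂_mono fun S _ => 𝕋.ext_mono h S t

theorem le_lift {X Y : Type u} (α : 𝕋.TRel X Y) (S : 𝕋.T (𝕋.T X)) (t : 𝕋.T Y) :
    𝕋.ext α S t ≤ 𝕋.lift α (𝕋.m X S) t :=
  le_iSup₂_of_le S rfl le_rfl

theorem le_comp {X Y Z : Type u} (β : 𝕋.TRel Y Z) (α : 𝕋.TRel X Y) (s : 𝕋.T X) (t : 𝕋.T Y)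
    (z : Z) : 𝕋.lift α s t * β t z ≤ 𝕋.comp β α s z :=
  le_iSup (fun t : 𝕋.T Y => 𝕋.lift α s t * β t z) t

theorem comp_mono {X Y Z : Type u} {β β' : 𝕋.TRel Y Z} {α α' : 𝕋.TRel X Y}
    (hβ : β ≤ β') (hα : α ≤ α') : 𝕋.comp β α ≤ 𝕋.comp β' α' := by
  intro s z
  exact iSup_mono fun t => mul_le_mul' (𝕋.lift_mono hα s t) (hβ t z)

/-- `T_ξ` commutes with pulling back along a map in the second variable. -/
theorem ext_pull {X Y Z : Type u} (r : X → Y → V) (g : Z → Y) (s : 𝕋.T X) (t : 𝕋.T Z) :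
    𝕋.ext (fun x z => r x (g z)) s t = 𝕋.ext r s (𝕋.map g t) := by
  apply le_antisymm
  · refine iSup₂_le fun w hw => ?_
    obtain ⟨rfl, rfl⟩ := hw
    have h := 𝕋.le_ext r (𝕋.map (fun p : X × Z => (p.1, g p.2)) w)
    simpa only [map, fmap_fmap] using h
  · refine iSup₂_le fun w hw => ?_
    obtain ⟨rfl, hw⟩ := hw
    obtain ⟨w', h1, h2⟩ := 𝕋.map_weakPullback Prod.snd g w t hw
    refine le_iSup₂_of_le (𝕋.map (fun p => (p.1.1.1, p.1.2)) w') ⟨?_, ?_⟩ ?_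
    · simp only [map, fmap_fmap, ← h1]
    · simp only [map, fmap_fmap, ← h2]
    · refine le_of_eq ?_
      simp only [map, fmap_fmap, ← h1]
      congr 2
      funext p
      rw [p.2]

/-- `T_ξ` commutes with pushing forward along a map in the first variable. -/
theorem ext_push {X X' Y : Type u} (f : X → X') (r : X → Y → V) (s : 𝕋.T X') (t : 𝕋.T Y) :
    𝕋.ext (fun x' y => ⨆ (x : X) (_ : f x = x'), r x y) s t
      = ⨆ (s₀ : 𝕋.T X) (_ : 𝕋.map f s₀ = s), 𝕋.ext r s₀ t := by
  apply le_antisymm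
  · refine iSup₂_le fun w hw => ?_
    obtain ⟨rfl, rfl⟩ := hw
    have key : (fun p : X' × Y => ⨆ (x : X) (_ : f x = p.1), r x p.2)
        ≤ pushforward (fun p : X × Y => (f p.1, p.2)) (fun p => r p.1 p.2) := by
      rintro ⟨x', y⟩
      refine iSup₂_le fun x hx => le_iSup₂_of_le (x, y) ?_ le_rfl
      simp only [hx]
    refine (𝕋.ξ_mono _ _ key w).trans ?_
    rw [𝕋.ξ_natural]
    refine iSup₂_le fun w₀ hw₀ => ?_
    subst hw₀
    refine le_iSup₂_of_le (𝕋.map Prod.fst w₀) ?_ ?_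
    · simp only [map, fmap_fmap]
    · have h := 𝕋.le_ext r w₀
      simpa only [map, fmap_fmap] using h
  · refine iSup₂_le fun s₀ hs₀ => iSup₂_le fun w hw => ?_
    obtain ⟨rfl, rfl⟩ := hw
    subst hs₀
    refine le_iSup₂_of_le (𝕋.map (fun p : X × Y => (f p.1, p.2)) w) ⟨?_, ?_⟩ ?_
    · simp only [map, fmap_fmap]
    · simp only [map, fmap_fmap]
    · simp only [map, fmap_fmap]
      refine 𝕋.ξ_mono _ _ ?_ w
      intro p
      exact le_iSup₂_of_le (f := fun (x : X) (_ : f x = f p.1) => r x p.2) p.1 rfl le_rfl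

theorem ξ_mul_map {X : Type u} (φ ψ : X → V) (t : 𝕋.T X) :
    𝕋.ξ (𝕋.map (fun x => φ x * ψ x) t) = 𝕋.ξ (𝕋.map φ t) * 𝕋.ξ (𝕋.map ψ t) := by
  have h := 𝕋.ξ_mul (𝕋.map (fun x => (φ x, ψ x)) t)
  simpa only [map, fmap_fmap] using h

theorem ξ_one_map {X : Type u} (t : 𝕋.T X) : 𝕋.ξ (𝕋.map (fun _ => (1 : V)) t) = 1 := by
  have h := 𝕋.ξ_one (𝕋.map (fun _ => PUnit.unit) t)
  simpa only [map, fmap_fmap] using h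

/-- `T_ξ` preserves composition of `V`-relations. -/
theorem ext_comp {X Y Z : Type u} (r : X → Y → V) (q : Y → Z → V) (s : 𝕋.T X) (t : 𝕋.T Z) :
    𝕋.ext (fun x z => ⨆ y, r x y * q y z) s t = ⨆ c : 𝕋.T Y, 𝕋.ext r s c * 𝕋.ext q c t := by
  apply le_antisymm
  · refine iSup₂_le fun w hw => ?_
    obtain ⟨rfl, rfl⟩ := hw
    have key : (fun p : X × Z => ⨆ y, r p.1 y * q y p.2)
        ≤ pushforward (fun p : X × Y × Z => (p.1, p.2.2))
          (fun p => r p.1 p.2.1 * q p.2.1 p.2.2) := by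
      rintro ⟨x, z⟩
      exact iSup_le fun y => le_iSup₂_of_le (x, y, z) rfl le_rfl
    refine (𝕋.ξ_mono _ _ key w).trans ?_
    rw [𝕋.ξ_natural]
    refine iSup₂_le fun w₀ hw₀ => ?_
    subst hw₀
    refine (𝕋.ξ_mul_map (fun p : X × Y × Z => r p.1 p.2.1) (fun p => q p.2.1 p.2.2) w₀).le.trans ?_
    refine le_iSup_of_le (𝕋.map (fun p : X × Y × Z => p.2.1) w₀) ?_
    have h1 := 𝕋.le_ext r (𝕋.map (fun p : X × Y × Z => (p.1, p.2.1)) w₀)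
    have h2 := 𝕋.le_ext q (𝕋.map (fun p : X × Y × Z => p.2) w₀)
    simp only [map, fmap_fmap] at h1 h2 ⊢
    exact mul_le_mul' h1 h2
  · refine iSup_le fun c => ?_
    rw [show 𝕋.ext r s c = ⨆ (w : 𝕋.T (X × Y))
      (_ : 𝕋.map Prod.fst w = s ∧ 𝕋.map Prod.snd w = c), _ from rfl]
    simp only [iSup_mul_sort]
    refine iSup₂_le fun w₁ h₁ => ?_
    simp only [ext, mul_iSup_sort]
    refine iSup₂_le fun w₂ h₂ => ?_
    obtain ⟨rfl, h₁⟩ := h₁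
    obtain ⟨h₂, rfl⟩ := h₂
    obtain ⟨w, hw₁, hw₂⟩ := 𝕋.map_weakPullback Prod.snd Prod.fst w₁ w₂ (h₁.trans h₂.symm)
    refine le_iSup₂_of_le (𝕋.map (fun p => (p.1.1.1, p.1.2.2)) w) ⟨?_, ?_⟩ ?_
    · simp only [map, fmap_fmap, ← hw₁]
    · simp only [map, fmap_fmap, ← hw₂]
    · simp only [map, fmap_fmap, ← hw₁, ← hw₂]
      refine (𝕋.ξ_mul_map _ _ w).symm.le.trans ?_
      refine 𝕋.ξ_mono _ _ ?_ w
      intro p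
      refine le_iSup_of_le p.1.1.2 ?_
      simp only [p.2, le_refl]

/-- `m` is natural with respect to `T_ξ`. -/
theorem ext_mult {A B : Type u} (r : A → B → V) (s : 𝕋.T A) (t : 𝕋.T (𝕋.T B)) :
    𝕋.ext r s (𝕋.m B t) = ⨆ (S : 𝕋.T (𝕋.T A)) (_ : 𝕋.m A S = s), 𝕋.ext (𝕋.ext r) S t := by
  have hξ : ∀ W : 𝕋.T (𝕋.T (A × B)), 𝕋.ξ (𝕋.map (fun p : A × B => r p.1 p.2) (𝕋.m _ W))
      = 𝕋.ξ (𝕋.map (fun w => 𝕋.ξ (𝕋.map (fun p : A × B => r p.1 p.2) w)) W) := by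
    intro W
    rw [show 𝕋.map (fun p : A × B => r p.1 p.2) (𝕋.m _ W) = _ from fmap_mult _ _ W, 𝕋.ξ_mult,
      fmap_fmap]
  apply le_antisymm
  · refine iSup₂_le fun w hw => ?_
    obtain ⟨rfl, hw⟩ := hw
    obtain ⟨W, rfl, rfl⟩ := 𝕋.mult_weakPullback Prod.snd w t hw
    refine le_iSup₂_of_le (𝕋.map (𝕋.map Prod.fst) W) (fmap_mult _ _ _).symm ?_
    rw [hξ]
    have h := 𝕋.le_ext (𝕋.ext r) (𝕋.map (fun w => (𝕋.map Prod.fst w, 𝕋.map Prod.snd w)) W)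
    simp only [map, fmap_fmap] at h
    exact (𝕋.ξ_mono _ _ (fun w => 𝕋.le_ext r w) W).trans h
  · refine iSup₂_le fun S hS => iSup₂_le fun W' hW' => ?_
    obtain ⟨rfl, rfl⟩ := hW'
    subst hS
    have key : (fun p : 𝕋.T A × 𝕋.T B => 𝕋.ext r p.1 p.2)
        ≤ pushforward (fun w : 𝕋.T (A × B) => (𝕋.map Prod.fst w, 𝕋.map Prod.snd w))
          (fun w => 𝕋.ξ (𝕋.map (fun p : A × B => r p.1 p.2) w)) := by
      rintro ⟨a, b⟩
      refine iSup₂_le fun w hw => le_iSup₂_of_le w (Prod.ext hw.1 hw.2) le_rfl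
    refine (𝕋.ξ_mono _ _ key W').trans ?_
    rw [𝕋.ξ_natural]
    refine iSup₂_le fun W hW => ?_
    subst hW
    refine (hξ W).symm.le.trans ((𝕋.le_ext r _).trans (le_of_eq ?_))
    simp only [map, m, fmap_fmap, fmap_mult]

theorem lift_mult {X Y : Type u} (α : 𝕋.TRel X Y) (s : 𝕋.T X) (t : 𝕋.T (𝕋.T Y)) :
    𝕋.lift α s (𝕋.m Y t)
      = ⨆ (S : 𝕋.T (𝕋.T X)) (_ : 𝕋.m X S = s), 𝕋.ext (𝕋.lift α) S t := by
  have h2 : ∀ S : 𝕋.T (𝕋.T X), 𝕋.ext (𝕋.lift α) S t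
      = ⨆ (R : 𝕋.T (𝕋.T (𝕋.T X))) (_ : 𝕋.map (𝕋.m X) R = S), 𝕋.ext (𝕋.ext α) R t :=
    fun S => 𝕋.ext_push (𝕋.m X) (𝕋.ext α) S t
  simp only [h2]
  simp only [lift, 𝕋.ext_mult]
  apply le_antisymm
  · refine iSup₂_le fun S hS => iSup₂_le fun R hR => ?_
    subst hS hR
    exact le_iSup₂_of_le (𝕋.map (𝕋.m X) R) (mult_mult _ R) (le_iSup₂_of_le R rfl le_rfl)
  · refine iSup₂_le fun S hS => iSup₂_le fun R hR => ?_
    subst hS hR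
    exact le_iSup₂_of_le (𝕋.m _ R) (mult_mult _ R).symm (le_iSup₂_of_le R rfl le_rfl)

theorem lift_comp {X Y Z : Type u} (β : 𝕋.TRel Y Z) (α : 𝕋.TRel X Y) (s : 𝕋.T X) (u : 𝕋.T Z) :
    𝕋.lift (𝕋.comp β α) s u = ⨆ t : 𝕋.T Y, 𝕋.lift α s t * 𝕋.lift β t u := by
  have h1 : ∀ S : 𝕋.T (𝕋.T X), 𝕋.ext (𝕋.comp β α) S u
      = ⨆ c : 𝕋.T (𝕋.T Y), 𝕋.ext (𝕋.lift α) S c * 𝕋.ext β c u :=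
    fun S => 𝕋.ext_comp (𝕋.lift α) β S u
  apply le_antisymm
  · refine iSup₂_le fun S hS => ?_
    rw [h1]
    refine iSup_le fun c => le_iSup_of_le (𝕋.m Y c) ?_
    refine mul_le_mul' ?_ (𝕋.le_lift β c u)
    rw [lift_mult]
    exact le_iSup₂_of_le S hS le_rfl
  · refine iSup_le fun t => ?_
    rw [show 𝕋.lift β t u = ⨆ (c : 𝕋.T (𝕋.T Y)) (_ : 𝕋.m Y c = t), 𝕋.ext β c u from rfl]
    simp only [mul_iSup_sort]
    refine iSup₂_le fun c hc => ?_
    subst hc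
    rw [lift_mult]
    simp only [iSup_mul_sort]
    refine iSup₂_le fun S hS => le_iSup₂_of_le S hS ?_
    rw [h1]
    exact le_iSup (fun c : 𝕋.T (𝕋.T Y) => 𝕋.ext (𝕋.lift α) S c * 𝕋.ext β c u) c

/-- The Kleisli convolution is associative. -/
theorem comp_assoc {W X Y Z : Type u} (γ : 𝕋.TRel Y Z) (β : 𝕋.TRel X Y) (α : 𝕋.TRel W X) :
    𝕋.comp (𝕋.comp γ β) α = 𝕋.comp γ (𝕋.comp β α) := by
  funext s z
  have h1 : 𝕋.comp (𝕋.comp γ β) α s z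
      = ⨆ (t : 𝕋.T X) (c : 𝕋.T Y), 𝕋.lift α s t * (𝕋.lift β t c * γ c z) := by
    simp only [comp, mul_iSup_sort]
  have h2 : 𝕋.comp γ (𝕋.comp β α) s z
      = ⨆ (c : 𝕋.T Y) (t : 𝕋.T X), 𝕋.lift α s t * 𝕋.lift β t c * γ c z := by
    rw [show 𝕋.comp γ (𝕋.comp β α) s z
      = ⨆ c : 𝕋.T Y, 𝕋.lift (𝕋.comp β α) s c * γ c z from rfl]
    simp only [lift_comp, iSup_mul_sort]
  rw [h1, h2, iSup_comm]
  simp only [mul_assoc]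

end Calculus

/-- A `𝕋`-category `(X, a)`: `k ≤ a (e_X x, x)` (that is, `e_X° ≤ a`) and `a ∘ a ≤ a`. -/
structure Cat where
  /-- The underlying set. -/
  carrier : Type u
  /-- The structure `a : T X → X → V`. -/
  str : 𝕋.TRel carrier carrier
  refl : ∀ x, 1 ≤ str (𝕋.e carrier x) x
  trans : 𝕋.comp str str ≤ str

/-- A `𝕋`-functor: a map `f` with `a (s, x) ≤ b (T f (s), f x)`. -/
@[ext]
structure Functor (X Y : 𝕋.Cat) where
  /-- The underlying map. -/
  toFun : X.carrier → Y.carrier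
  map_le : ∀ s x, X.str s x ≤ Y.str (𝕋.map toFun s) (toFun x)

/-- A `𝕋`-distributor from `(X, a)` to `(Y, b)`: `φ ∘ a ≤ φ` and `b ∘ φ ≤ φ`. -/
structure IsDistributor (X Y : 𝕋.Cat) (φ : 𝕋.TRel X.carrier Y.carrier) : Prop where
  comp_left : 𝕋.comp φ X.str ≤ φ
  comp_right : 𝕋.comp Y.str φ ≤ φ

variable {𝕋}

namespace Functor

/-- The identity `𝕋`-functor. -/
def id (X : 𝕋.Cat) : Functor 𝕋 X X where
  toFun := fun x => x
  map_le := fun s x => by rw [show 𝕋.map (fun x => x) s = s from fmap_id _ s]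

/-- The composite `g · f` of `𝕋`-functors. -/
def comp {X Y Z : 𝕋.Cat} (g : Functor 𝕋 Y Z) (f : Functor 𝕋 X Y) : Functor 𝕋 X Z where
  toFun := fun x => g.toFun (f.toFun x)
  map_le := fun s x => by
    have h := (f.map_le s x).trans (g.map_le _ _)
    simpa only [map, fmap_fmap] using h

variable {X Y : 𝕋.Cat}

/-- The `𝕋`-distributor `f_* = b · T f` from `X` to `Y`. -/
def lower (f : Functor 𝕋 X Y) : 𝕋.TRel X.carrier Y.carrier :=
  fun s y => Y.str (𝕋.map f.toFun s) y

/-- The `𝕋`-distributor `f^* = f° · b` from `Y` to `X`. -/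
def upper (f : Functor 𝕋 X Y) : 𝕋.TRel Y.carrier X.carrier :=
  fun t x => Y.str t (f.toFun x)

/-- The order on `𝕋`-functors: `f ≤ g` if and only if `f^* ≤ g^*`. -/
instance : LE (Functor 𝕋 X Y) where
  le f g := f.upper ≤ g.upper

/-- `f ⊣ g`: `1 ≤ g · f` and `f · g ≤ 1`. -/
def IsLeftAdjoint (f : Functor 𝕋 X Y) (g : Functor 𝕋 Y X) : Prop :=
  id X ≤ g.comp f ∧ f.comp g ≤ id Y

end Functor

/-- The restriction of a `𝕋`-category to a subset. -/
def Cat.sub (X : 𝕋.Cat) (p : X.carrier → Prop) : 𝕋.Cat where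
  carrier := {x : X.carrier // p x}
  str := fun s x => X.str (𝕋.map Subtype.val s) x.1
  refl := fun x => by
    rw [show 𝕋.map Subtype.val (𝕋.e _ x) = _ from fmap_unit _ _ x]
    exact X.refl x.1
  trans := by
    intro s x
    refine iSup_le fun t => ?_
    refine le_trans ?_ (X.trans (𝕋.map Subtype.val s) x.1)
    refine le_trans ?_ (𝕋.le_comp X.str X.str _ (𝕋.map Subtype.val t) x.1)
    refine mul_le_mul' ?_ le_rfl
    refine iSup₂_le fun S hS => ?_
    refine le_iSup₂_of_le (𝕋.map (𝕋.map Subtype.val) S) ?_ ?_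
    · rw [← hS]
      exact (fmap_mult _ _ S).symm
    · refine iSup₂_le fun w hw => ?_
      obtain ⟨rfl, rfl⟩ := hw
      have h := 𝕋.le_ext X.str (𝕋.map (fun p => (𝕋.map Subtype.val p.1, p.2.1)) w)
      simpa only [map, fmap_fmap] using h

/-- The free `𝕋`-category `G = (1, e_1°)` on a one-element set. -/
def point (𝕋 : TopologicalTheory V) : 𝕋.Cat where
  carrier := PUnit.{u + 1}
  str := fun s x => ⨆ _ : 𝕋.e PUnit.{u + 1} x = s, 1
  refl := fun x => le_iSup_of_le rfl le_rfl
  trans := by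
    rintro s x
    refine iSup_le fun t => ?_
    beta_reduce
    rw [mul_iSup_sort]
    refine iSup_le fun ht => ?_
    subst ht
    rw [mul_one]
    refine iSup₂_le fun S hS => iSup₂_le fun w hw => ?_
    have key : (fun p : 𝕋.T PUnit.{u + 1} × PUnit.{u + 1} =>
          (⨆ _ : 𝕋.e PUnit.{u + 1} p.2 = p.1, 1 : V))
        ≤ pushforward (fun x : PUnit.{u + 1} => (𝕋.e PUnit.{u + 1} x, x)) (fun _ => (1 : V)) := by
      rintro ⟨a, b⟩
      exact iSup_le fun h => le_iSup₂_of_le b (Prod.ext h rfl) le_rfl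
    refine (𝕋.ξ_mono _ _ key w).trans ?_
    rw [𝕋.ξ_natural]
    refine iSup₂_le fun v hv => ?_
    beta_reduce
    rw [show 𝕋.ξ (fmap 𝕋.monad (fun _ : PUnit.{u + 1} => (1 : V)) v) = 1 from 𝕋.ξ_one v]
    refine le_iSup_of_le ?_ le_rfl
    obtain ⟨h1, h2⟩ := hw
    subst hv
    simp only [map, fmap_fmap] at h1 h2
    rw [← hS, ← h1, show 𝕋.m _ (fmap 𝕋.monad _ v) = _ from mult_fmap_unit _ v,
      ← h2, show fmap 𝕋.monad (fun x : PUnit.{u + 1} => x) v = v from fmap_id _ v]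

/-- The `𝕋`-functor `x : G → X` picking out the element `x`. -/
def Cat.elem (X : 𝕋.Cat) (x : X.carrier) : Functor 𝕋 𝕋.point X where
  toFun := fun _ => x
  map_le := fun s y => by
    refine iSup_le fun h => ?_
    subst h
    have hx : 𝕋.map (fun _ : PUnit.{u + 1} => x) (𝕋.e PUnit.{u + 1} y) = 𝕋.e X.carrier x :=
      fmap_unit 𝕋.monad (fun _ : PUnit.{u + 1} => x) y
    exact (X.refl x).trans (le_of_eq (congrArg (fun s => X.str s x) hx.symm))

section Presheaves

open Quantale in
/-- The structure `⟦p, ψ⟧` on maps `T X → V` (it restricts to sets `S` of such maps, where, as `T`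
preserves weak pullbacks, it suffices to take `q ∈ T (T X × S)`):
`⟦p, ψ⟧ = ⋀ {hom (ξ (T ev (q)), ψ (m_X (T π₁ (q)))) | q ∈ T (T X × V^{T X}), T π₂ (q) = p}`. -/
def bracket (𝕋 : TopologicalTheory V) (X : Type u) (p : 𝕋.T (𝕋.T X → V)) (ψ : 𝕋.T X → V) : V :=
  ⨅ (q : 𝕋.T (𝕋.T X × (𝕋.T X → V))) (_ : 𝕋.map Prod.snd q = p),
    𝕋.ξ (𝕋.map (fun z => z.2 z.1) q) ⇨ₗ ψ (𝕋.m X (𝕋.map Prod.fst q))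

theorem le_bracket_iff {X Z : Type u} (χ : 𝕋.TRel X Z) (t : 𝕋.T Z) (ψ : 𝕋.T X → V) (v : V) :
    v ≤ 𝕋.bracket X (𝕋.map (fun z s => χ s z) t) ψ ↔ ∀ s, v * 𝕋.lift χ s t ≤ ψ s := by
  simp only [bracket, le_iInf_iff, Quantale.leftMulResiduation_le_iff_mul_le]
  have hl : ∀ S, 𝕋.ext χ S t
      = 𝕋.ext (fun s (φ : 𝕋.T X → V) => φ s) S (𝕋.map (fun z s => χ s z) t) :=
    fun S => 𝕋.ext_pull (fun s (φ : 𝕋.T X → V) => φ s) (fun z s => χ s z) S t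
  constructor
  · intro h s
    simp only [lift, hl, mul_iSup_sort]
    refine iSup₂_le fun S hS => ?_
    simp only [ext, mul_iSup_sort]
    refine iSup₂_le fun w hw => ?_
    have := h w hw.2
    rwa [hw.1, hS] at this
  · intro h q hq
    refine le_trans (mul_le_mul' le_rfl ?_) (h (𝕋.m X (𝕋.map Prod.fst q)))
    refine le_trans ?_ (𝕋.le_lift χ _ t)
    rw [hl]
    exact le_iSup₂_of_le q ⟨rfl, hq⟩ le_rfl

theorem bracket_mul_le {X Z : Type u} (χ : 𝕋.TRel X Z) (t : 𝕋.T Z) (ψ : 𝕋.T X → V) (s : 𝕋.T X) :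
    𝕋.bracket X (𝕋.map (fun z s => χ s z) t) ψ * 𝕋.lift χ s t ≤ ψ s :=
  (le_bracket_iff χ t ψ _).1 le_rfl s

/-- The `𝕋`-category `𝒫 X` of contravariant presheaves: the maps `ψ : T X → V` which are
`𝕋`-distributors from `X` to `G`, with the structure `⟦-, -⟧`. -/
def presheaf (X : 𝕋.Cat) : 𝕋.Cat where
  carrier := {ψ : 𝕋.T X.carrier → V // 𝕋.IsDistributor X 𝕋.point (fun s _ => ψ s)}
  str := fun p ψ => 𝕋.bracket X.carrier (𝕋.map Subtype.val p) ψ.1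
  refl := fun ψ => by
    rw [show 𝕋.map Subtype.val (𝕋.e _ ψ)
        = 𝕋.map (fun (_ : PUnit.{u + 1}) s => ψ.1 s) (𝕋.e PUnit.{u + 1} PUnit.unit) from by
      simp only [map, e, fmap_unit]]
    rw [le_bracket_iff (fun s (_ : PUnit.{u + 1}) => ψ.1 s)]
    intro s
    rw [one_mul]
    refine le_trans ?_ (ψ.2.comp_right s PUnit.unit)
    refine le_trans ?_ (𝕋.le_comp _ _ s (𝕋.e PUnit.{u + 1} PUnit.unit) PUnit.unit)
    have h : (1 : V) ≤ 𝕋.point.str (𝕋.e PUnit.{u + 1} PUnit.unit) PUnit.unit :=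
      𝕋.point.refl PUnit.unit
    exact (mul_one _).symm.le.trans (mul_le_mul' le_rfl h)
  trans := by
    set S := {ψ : 𝕋.T X.carrier → V // 𝕋.IsDistributor X 𝕋.point (fun s _ => ψ s)}
    set c : 𝕋.TRel S S := fun p ψ => 𝕋.bracket X.carrier (𝕋.map Subtype.val p) ψ.1 with hc
    set ev : 𝕋.TRel X.carrier S := fun s ψ => ψ.1 s with hev
    have h1 : 𝕋.comp c ev ≤ ev := by
      intro s ψ
      refine iSup_le fun p => ?_
      rw [mul_comm]
      exact bracket_mul_le ev p ψ.1 s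
    have h2 : 𝕋.comp (𝕋.comp c c) ev ≤ ev := by
      rw [comp_assoc]
      exact (𝕋.comp_mono le_rfl h1).trans h1
    intro p ψ
    refine (le_bracket_iff ev p ψ.1 _).2 fun s => ?_
    rw [mul_comm]
    exact (𝕋.le_comp (𝕋.comp c c) ev s p ψ).trans (h2 s ψ)

end Presheaves

/-- A class `Φ` of `𝕋`-distributors with the closure properties required in the theory of
`Φ`-cocompleteness. -/
structure DistributorClass (𝕋 : TopologicalTheory V) where
  /-- Membership in the class. -/
  mem : ∀ X Y : 𝕋.Cat, 𝕋.TRel X.carrier Y.carrier → Prop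
  isDistributor : ∀ {X Y : 𝕋.Cat} {φ : 𝕋.TRel X.carrier Y.carrier},
    mem X Y φ → 𝕋.IsDistributor X Y φ
  /-- `f^* ∈ Φ` for every `𝕋`-functor `f`. -/
  upper_mem : ∀ {X Y : 𝕋.Cat} (f : Functor 𝕋 X Y), mem Y X f.upper
  /-- `f^* ∘ φ ∈ Φ`. -/
  upper_comp_mem : ∀ {A X Y : 𝕋.Cat} {φ : 𝕋.TRel Y.carrier X.carrier} (f : Functor 𝕋 A X),
    mem Y X φ → mem Y A (𝕋.comp f.upper φ)
  /-- `φ ∘ f^* ∈ Φ`. -/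
  comp_upper_mem : ∀ {A X Y : 𝕋.Cat} {φ : 𝕋.TRel A.carrier Y.carrier} (f : Functor 𝕋 A X),
    mem A Y φ → mem X Y (𝕋.comp φ f.upper)
  /-- `f_* ∈ Φ` implies `φ ∘ f_* ∈ Φ`. -/
  comp_lower_mem : ∀ {A X Y : 𝕋.Cat} {φ : 𝕋.TRel X.carrier Y.carrier} (f : Functor 𝕋 A X),
    mem X Y φ → mem A X f.lower → mem A Y (𝕋.comp φ f.lower)
  /-- If `y^* ∘ φ ∈ Φ` for all points `y` of the codomain, then `φ ∈ Φ`. -/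
  mem_of_elem : ∀ {X Y : 𝕋.Cat} {φ : 𝕋.TRel X.carrier Y.carrier}, 𝕋.IsDistributor X Y φ →
    (∀ y : Y.carrier, mem X 𝕋.point (𝕋.comp (Y.elem y).upper φ)) → mem X Y φ

/-- `g` is a colimit of `h : Y → X` weighted by the `𝕋`-distributor `φ` from `Y` to `Z`:
`g_* = h_* ⟜ φ`. -/
def IsColimit {X Y Z : 𝕋.Cat} (φ : 𝕋.TRel Y.carrier Z.carrier) (h : Functor 𝕋 Y X)
    (g : Functor 𝕋 Z X) : Prop :=
  g.lower = 𝕋.extension h.lower φ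

namespace DistributorClass

variable (Φ : DistributorClass 𝕋)

/-- `f` is `Φ`-dense: `f_* ∈ Φ`. -/
def Dense {X Y : 𝕋.Cat} (f : Functor 𝕋 X Y) : Prop := Φ.mem X Y f.lower

/-- `X` is `Φ`-cocomplete: all colimits in `X` weighted by members of `Φ` exist. -/
def Cocomplete (X : 𝕋.Cat) : Prop :=
  ∀ (Y Z : 𝕋.Cat) (φ : 𝕋.TRel Y.carrier Z.carrier) (h : Functor 𝕋 Y X), Φ.mem Y Z φ →
    ∃ g : Functor 𝕋 Z X, IsColimit φ h g

/-- `Φ X = {ψ ∈ 𝒫 X | ψ ∈ Φ}`, as a subcategory of `𝒫 X`. -/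
def obj (X : 𝕋.Cat) : 𝕋.Cat :=
  (presheaf X).sub fun ψ => Φ.mem X 𝕋.point (fun s _ => ψ.1 s)

variable {Φ} {X : 𝕋.Cat}

/-- The map `T X → V` underlying an element of `Φ X`. -/
def val (ψ : (Φ.obj X).carrier) : 𝕋.T X.carrier → V := ψ.1.1

/-- An element of `Φ X` as a `𝕋`-relation from `X` to the one-element set. -/
def toRel (ψ : (Φ.obj X).carrier) : 𝕋.TRel X.carrier 𝕋.point.carrier := fun s _ => val ψ s

/-- The element of `Φ X` given by a member of `Φ` from `X` to `G`. -/
def ofMem (ψ : 𝕋.TRel X.carrier 𝕋.point.carrier) (h : Φ.mem X 𝕋.point ψ) :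
    (Φ.obj X).carrier :=
  ⟨⟨fun s => ψ s PUnit.unit, Φ.isDistributor h⟩, h⟩

theorem toRel_mem (ψ : (Φ.obj X).carrier) : Φ.mem X 𝕋.point (toRel ψ) := ψ.2

theorem le_str_iff {Z : Type u} (k : Z → (Φ.obj X).carrier) (t : 𝕋.T Z)
    (ψ : (Φ.obj X).carrier) (v : V) :
    v ≤ (Φ.obj X).str (𝕋.map k t) ψ ↔
      ∀ s, v * 𝕋.lift (fun s z => val (k z) s) s t ≤ val ψ s := by
  rw [← le_bracket_iff]
  have h : 𝕋.map Subtype.val (𝕋.map Subtype.val (𝕋.map k t))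
      = 𝕋.map (fun z s => val (k z) s) t := by
    simp only [TopologicalTheory.map]
    erw [fmap_fmap, fmap_fmap]
    rfl
  rw [← h]
  exact Iff.rfl

/-- Composition with a `𝕋`-relation `α`, whenever it gives a map `Φ Y → Φ X`, is functorial. -/
theorem str_le_of_comp {Y : 𝕋.Cat} (α : 𝕋.TRel X.carrier Y.carrier)
    (k : (Φ.obj Y).carrier → (Φ.obj X).carrier)
    (hk : ∀ ψ, toRel (k ψ) = 𝕋.comp (toRel ψ) α) (p : 𝕋.T (Φ.obj Y).carrier)
    (ψ : (Φ.obj Y).carrier) :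
    (Φ.obj Y).str p ψ ≤ (Φ.obj X).str (𝕋.map k p) (k ψ) := by
  rw [le_str_iff]
  intro s
  have hval : ∀ (ψ : (Φ.obj Y).carrier) s, val (k ψ) s = ⨆ t, 𝕋.lift α s t * val ψ t :=
    fun ψ s => congrFun (congrFun (hk ψ) s) PUnit.unit
  have h1 : (fun s ψ => val (k ψ) s) = 𝕋.comp (fun t (ψ : (Φ.obj Y).carrier) => val ψ t) α := by
    funext s ψ
    exact hval ψ s
  rw [h1, 𝕋.lift_comp, hval, mul_iSup_sort]
  refine iSup_mono fun t => ?_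
  rw [mul_left_comm]
  refine mul_le_mul' le_rfl ?_
  have h2 := (le_str_iff (Φ := Φ) (fun ψ : (Φ.obj Y).carrier => ψ) p ψ ((Φ.obj Y).str p ψ)).1
    (by rw [show 𝕋.map (fun ψ : (Φ.obj Y).carrier => ψ) p = p from fmap_id _ p])
  exact h2 t

variable (Φ X)

/-- The restricted Yoneda functor `y_X^Φ : X → Φ X`, `x ↦ a (-, x) = x^*`. -/
def yoneda : Functor 𝕋 X (Φ.obj X) where
  toFun := fun x => ofMem (X.elem x).upper (Φ.upper_mem _)
  map_le := fun t x => by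
    rw [le_str_iff]
    intro s
    rw [mul_comm]
    exact (𝕋.le_comp X.str X.str s t x).trans (X.trans s x)

variable {X} {Y : 𝕋.Cat}

/-- The `𝕋`-functor `Φ f : Φ X → Φ Y`, `ψ ↦ ψ ∘ f^*`. -/
def map (f : Functor 𝕋 X Y) : Functor 𝕋 (Φ.obj X) (Φ.obj Y) where
  toFun := fun ψ => ofMem (𝕋.comp (toRel ψ) f.upper) (Φ.comp_upper_mem f (toRel_mem ψ))
  map_le := str_le_of_comp f.upper _ fun _ => rfl

/-- The `𝕋`-functor `f⁻¹ : Φ Y → Φ X`, `ψ ↦ ψ ∘ f_*`, for `Φ`-dense `f`. -/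
def inverse (f : Functor 𝕋 X Y) (hf : Φ.Dense f) : Functor 𝕋 (Φ.obj Y) (Φ.obj X) where
  toFun := fun ψ => ofMem (𝕋.comp (toRel ψ) f.lower) (Φ.comp_lower_mem f (toRel_mem ψ) hf)
  map_le := str_le_of_comp f.lower _ fun _ => rfl

end DistributorClass

end TopologicalTheory

end TopTh

/-! Everything rests on the universal property `le_str_iff` of the presheaf structure: `v` lies
below the value at `(T k (t), ψ)` exactly when `v ⊗ (T_ξ χ · m°)(s, t) ≤ ψ s` for all `s`, where `χ
(s, z) = (k z) s`. Taking `k` to be the Yoneda map gives the Yoneda lemma `yoneda_lower`: `(y_X)_*`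
is evaluation.

Density follows: `ψ^* ∘ (y_X)_* = ψ` for every `ψ` in `Φ X`, so each fibre of `(y_X)_*` is in `Φ`,
and (Ax 3) applies. The same identity says that `y_X⁻¹ · y_{ΦX}` is the identity, which supplies the
counit of `y_X⁻¹ ⊣ y_{ΦX}`. The unit is the inequality between one term of `Ψ ∘ (y_X)_*` and the
whole supremum. The adjunction `Φ f ⊣ f⁻¹` is `f_* ⊣ f^*` under precomposition. Left adjoints into
`Φ X` are unique, not merely up to equivalence, because the order of `Φ X` is pointwise and hence
antisymmetric.

For cocompleteness, the colimit of `h` weighted by `φ` sends `z` to `z^* ∘ φ ∘ h^* ∘ (y_X)_*`. The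
closure axioms and density put this in `Φ`, and `lift_comp` turns the universal property of the
presheaf structure into that of the extension. -/

namespace TopTh

namespace TopologicalTheory

/-! ### Unit laws, reindexing and the underlying order -/

variable {V : Type u} [CommMonoid V] [CompleteLattice V] [IsQuantale V] {𝕋 : TopologicalTheory V}

/-- The witness is the unit at the pair `(s, y)`: `ξ` returns `α s y` there, and `m` collapses the
unit at `s` back to `s`. -/
theorem le_lift_unit {X Y : Type u} (α : 𝕋.TRel X Y) (s : 𝕋.T X) (y : Y) :
    α s y ≤ 𝕋.lift α s (𝕋.e Y y) := by
  have h := (𝕋.le_ext α (𝕋.e (𝕋.T X × Y) (s, y))).trans (𝕋.le_lift α _ _)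
  simpa only [map, e, m, fmap_unit, mult_unit, 𝕋.ξ_unit] using h

/-- Reflexivity, lifted: push `s` along `x ↦ (e x, x)`. Since `m · T e = 1`, both legs end at `s`,
and `ξ · T a` is at least `ξ · T 1 = 1`. -/
theorem Cat.one_le_lift_str (X : 𝕋.Cat) (s : 𝕋.T X.carrier) : 1 ≤ 𝕋.lift X.str s s := by
  have h := (𝕋.le_ext X.str (𝕋.map (fun x => (𝕋.e X.carrier x, x)) s)).trans (𝕋.le_lift X.str _ _)
  simp only [map, m, e, fmap_fmap, mult_fmap_unit, fmap_id] at h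
  refine le_trans ?_ h
  rw [← 𝕋.ξ_one_map s]
  exact 𝕋.ξ_mono _ _ X.refl s

theorem Cat.le_str_comp {X : Type u} (Y : 𝕋.Cat) (φ : 𝕋.TRel X Y.carrier) :
    φ ≤ 𝕋.comp Y.str φ := by
  intro s y
  refine le_trans ?_ (𝕋.le_comp Y.str φ s (𝕋.e _ y) y)
  refine (mul_one _).symm.le.trans ?_
  exact mul_le_mul' (le_lift_unit φ s y) (Y.refl y)

theorem Cat.le_comp_str {Y : Type u} (X : 𝕋.Cat) (φ : 𝕋.TRel X.carrier Y) :
    φ ≤ 𝕋.comp φ X.str := by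
  intro s y
  refine le_trans ?_ (𝕋.le_comp φ X.str s s y)
  refine (one_mul _).symm.le.trans ?_
  exact mul_le_mul' (X.one_le_lift_str s) le_rfl

theorem IsDistributor.str_comp {X Y : 𝕋.Cat} {φ : 𝕋.TRel X.carrier Y.carrier}
    (h : 𝕋.IsDistributor X Y φ) : 𝕋.comp Y.str φ = φ :=
  le_antisymm h.comp_right (Y.le_str_comp φ)

theorem lift_pull {X Y Z : Type u} (α : 𝕋.TRel X Y) (g : Z → Y) (s : 𝕋.T X) (t : 𝕋.T Z) :
    𝕋.lift (fun x z => α x (g z)) s t = 𝕋.lift α s (𝕋.map g t) := by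
  simp only [lift, ext_pull]

theorem lift_map_le (X : 𝕋.Cat) {Y : 𝕋.Cat} (f : Functor 𝕋 X Y) (s t : 𝕋.T X.carrier) :
    𝕋.lift X.str s t ≤ 𝕋.lift Y.str (𝕋.map f.toFun s) (𝕋.map f.toFun t) := by
  refine iSup₂_le fun S hS => iSup₂_le fun w hw => ?_
  obtain ⟨rfl, rfl⟩ := hw
  subst hS
  have h := (𝕋.le_ext Y.str (𝕋.map (fun p => (𝕋.map f.toFun p.1, f.toFun p.2)) w)).trans
    (𝕋.le_lift Y.str _ _)
  simp only [map, m, fmap_fmap, fmap_mult] at h ⊢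
  exact (𝕋.ξ_mono _ _ (fun p => f.map_le p.1 p.2) w).trans h

/-- `x ≤ x'` in the underlying order iff `a (-, x) ≤ a (-, x')`. -/
theorem Cat.one_le_str_iff (X : 𝕋.Cat) (x x' : X.carrier) :
    1 ≤ X.str (𝕋.e _ x) x' ↔ ∀ s, X.str s x ≤ X.str s x' := by
  refine ⟨fun h s => ?_, fun h => (X.refl x).trans (h _)⟩
  refine le_trans ?_ (X.trans s x')
  -- Transitivity through the middle point `e x`.
  refine le_trans ?_ (𝕋.le_comp X.str X.str s (𝕋.e _ x) x')
  refine (mul_one _).symm.le.trans ?_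
  exact mul_le_mul' (le_lift_unit _ s x) h

/-! ### The distributors `f_*` and `f^*` and their adjunction -/

namespace Functor

variable {X Y : 𝕋.Cat}

theorem le_iff (f g : Functor 𝕋 X Y) :
    f ≤ g ↔ ∀ x s, Y.str s (f.toFun x) ≤ Y.str s (g.toFun x) :=
  ⟨fun h x s => h s x, fun h s x => h x s⟩

/-- By `Cat.one_le_str_iff` the order is detected by the single value at `e x`, which a functor does
not decrease and whose argument it preserves by naturality of `e`. -/
theorem str_mono (f : Functor 𝕋 X Y) {x x' : X.carrier} (h : ∀ s, X.str s x ≤ X.str s x')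
    (t : 𝕋.T Y.carrier) : Y.str t (f.toFun x) ≤ Y.str t (f.toFun x') := by
  refine (Y.one_le_str_iff _ _).1 ?_ t
  refine ((X.one_le_str_iff x x').2 h).trans ((f.map_le _ _).trans (le_of_eq ?_))
  rw [show 𝕋.map f.toFun (𝕋.e _ x) = _ from fmap_unit _ f.toFun x]

theorem isDistributor_lower (f : Functor 𝕋 X Y) : 𝕋.IsDistributor X Y f.lower where
  comp_left := fun s y => by
    refine iSup_le fun t => ?_
    exact (mul_le_mul' (lift_map_le X f s t) le_rfl).trans
      ((𝕋.le_comp Y.str Y.str _ (𝕋.map f.toFun t) y).trans (Y.trans _ y))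
  comp_right := fun s y => by
    refine iSup_le fun t => ?_
    refine le_trans (mul_le_mul' ?_ le_rfl)
      ((𝕋.le_comp Y.str Y.str (𝕋.map f.toFun s) t y).trans (Y.trans _ y))
    refine iSup₂_le fun S hS => iSup₂_le fun w hw => ?_
    obtain ⟨rfl, rfl⟩ := hw
    subst hS
    have h := (𝕋.le_ext Y.str (𝕋.map (fun p => (𝕋.map f.toFun p.1, p.2)) w)).trans
      (𝕋.le_lift Y.str _ _)
    simp only [map, m, fmap_fmap, fmap_mult] at h ⊢
    exact h

/-- `f^* ∘ φ` is `b ∘ φ` reindexed along `f` by definition, and `b ∘ φ = φ` for a distributor. -/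
theorem upper_comp (f : Functor 𝕋 X Y) {Z : 𝕋.Cat} {φ : 𝕋.TRel Z.carrier Y.carrier}
    (hφ : 𝕋.IsDistributor Z Y φ) : 𝕋.comp f.upper φ = fun s x => φ s (f.toFun x) := by
  funext s x
  exact congrFun (congrFun hφ.str_comp s) (f.toFun x)

/-- Unit of `f_* ⊣ f^*`; by `upper_comp` it is functoriality of `f` itself. -/
theorem str_le_upper_comp_lower (f : Functor 𝕋 X Y) : X.str ≤ 𝕋.comp f.upper f.lower := by
  rw [f.upper_comp f.isDistributor_lower]
  exact f.map_le

theorem lower_comp_upper_le (f : Functor 𝕋 X Y) : 𝕋.comp f.lower f.upper ≤ Y.str := by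
  intro t y
  refine iSup_le fun s => ?_
  rw [show 𝕋.lift f.upper t s = _ from lift_pull Y.str f.toFun t s]
  exact (𝕋.le_comp Y.str Y.str t _ y).trans (Y.trans t y)

end Functor

/-! ### The Yoneda lemma and density -/

namespace DistributorClass

variable (Φ : DistributorClass 𝕋)

/-- The Yoneda lemma: `(y_X)_* (s, ψ) = ψ s`. -/
theorem yoneda_lower (X : 𝕋.Cat) : (Φ.yoneda X).lower = fun s ψ => val ψ s := by
  funext t ψ
  have key : ∀ v, v ≤ (Φ.yoneda X).lower t ψ ↔ ∀ s, v * 𝕋.lift X.str s t ≤ val ψ s :=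
    fun v => le_str_iff (Φ.yoneda X).toFun t ψ v
  apply le_antisymm
  -- Test at `s = t`, where the lifted structure is at least `1`; the converse below is the
  -- distributor law `ψ ∘ a ≤ ψ`.
  · refine le_trans ?_ ((key _).1 le_rfl t)
    exact (mul_one _).symm.le.trans (mul_le_mul' le_rfl (X.one_le_lift_str t))
  · refine (key _).2 fun s => ?_
    rw [mul_comm]
    exact (𝕋.le_comp (toRel ψ) X.str s t PUnit.unit).trans
      ((Φ.isDistributor (toRel_mem ψ)).comp_left s PUnit.unit)

variable {Φ} {X Y : 𝕋.Cat}

theorem val_injective : Function.Injective (val : (Φ.obj X).carrier → 𝕋.T X.carrier → V) :=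
  fun _ _ h => Subtype.ext (Subtype.ext h)

theorem elem_upper_comp_yoneda_lower (ψ : (Φ.obj X).carrier) :
    𝕋.comp ((Φ.obj X).elem ψ).upper (Φ.yoneda X).lower = toRel ψ := by
  rw [Functor.upper_comp _ (Functor.isDistributor_lower _), yoneda_lower]
  rfl

variable (Φ X) in
-- (Ax 3) reduces membership of `(y_X)_*` to its fibres, and the fibre over `ψ` is `ψ` itself.
theorem dense_yoneda : Φ.Dense (Φ.yoneda X) :=
  Φ.mem_of_elem (Functor.isDistributor_lower _) fun ψ => by
    rw [elem_upper_comp_yoneda_lower]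
    exact toRel_mem ψ

/-- The underlying order of `Φ X` is the pointwise order. -/
theorem str_le_str_iff (ψ ψ' : (Φ.obj X).carrier) :
    (∀ p, (Φ.obj X).str p ψ ≤ (Φ.obj X).str p ψ') ↔ val ψ ≤ val ψ' := by
  constructor
  · intro h s
    -- The representable points `p = T y (s)` suffice: by Yoneda the structure there evaluates a
    -- presheaf at `s`.
    have h0 : ∀ χ, (Φ.yoneda X).lower s χ = val χ s :=
      fun χ => congrFun (congrFun (Φ.yoneda_lower X) s) χ
    rw [← h0, ← h0]
    exact h _
  · intro h p
    have key := fun χ v => le_str_iff (Φ := Φ) (fun χ : (Φ.obj X).carrier => χ) p χ v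
    rw [show 𝕋.map (fun χ : (Φ.obj X).carrier => χ) p = p from fmap_id _ p] at key
    exact (key _ _).2 fun s => ((key _ _).1 le_rfl s).trans (h s)

/-! ### Adjunctions between presheaf categories -/

theorem functor_le_iff (f g : Functor 𝕋 Y (Φ.obj X)) :
    f ≤ g ↔ ∀ y, val (f.toFun y) ≤ val (g.toFun y) := by
  simp only [Functor.le_iff, str_le_str_iff]

/-- Precomposition is contravariant, so the unit `a ≤ f^* ∘ f_*` and counit `f_* ∘ f^* ≤ b` give the
unit and counit here in the same roles; `ψ` absorbs the structure because it is a distributor. -/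
theorem map_isLeftAdjoint_inverse (f : Functor 𝕋 X Y) (hf : Φ.Dense f) :
    (Φ.map f).IsLeftAdjoint (Φ.inverse f hf) := by
  constructor
  · rw [functor_le_iff]
    intro ψ s
    change toRel ψ s PUnit.unit
      ≤ 𝕋.comp (𝕋.comp (toRel ψ) f.upper) f.lower s PUnit.unit
    rw [comp_assoc]
    exact (X.le_comp_str (toRel ψ) s PUnit.unit).trans
      (𝕋.comp_mono le_rfl f.str_le_upper_comp_lower s PUnit.unit)
  · rw [functor_le_iff]
    intro ψ s
    change 𝕋.comp (𝕋.comp (toRel ψ) f.lower) f.upper s PUnit.unit ≤ toRel ψ s PUnit.unit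
    rw [comp_assoc]
    exact (𝕋.comp_mono le_rfl f.lower_comp_upper_le s PUnit.unit).trans
      ((Φ.isDistributor (toRel_mem ψ)).comp_left s PUnit.unit)

theorem inverse_yoneda_comp_yoneda (hy : Φ.Dense (Φ.yoneda X)) :
    (Φ.inverse (Φ.yoneda X) hy).comp (Φ.yoneda (Φ.obj X)) = Functor.id (Φ.obj X) := by
  ext1
  funext ψ
  apply val_injective
  funext s
  exact congrFun (congrFun (elem_upper_comp_yoneda_lower ψ) s) PUnit.unit

theorem inverse_yoneda_isLeftAdjoint (hy : Φ.Dense (Φ.yoneda X)) :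
    (Φ.inverse (Φ.yoneda X) hy).IsLeftAdjoint (Φ.yoneda (Φ.obj X)) := by
  constructor
  · rw [functor_le_iff]
    intro Ψ p
    have key := le_str_iff (Φ := Φ) (fun χ : (Φ.obj X).carrier => χ) p
      ((Φ.inverse (Φ.yoneda X) hy).toFun Ψ) (val Ψ p)
    rw [show 𝕋.map (fun χ : (Φ.obj X).carrier => χ) p = p from fmap_id _ p] at key
    refine key.2 fun s => ?_
    -- The evaluation relation is `(y_X)_*`, so the left side is the term at `p` of the supremum
    -- defining `Ψ ∘ (y_X)_*`.
    rw [mul_comm, ← yoneda_lower]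
    exact 𝕋.le_comp (toRel Ψ) (Φ.yoneda X).lower s p PUnit.unit
  · rw [inverse_yoneda_comp_yoneda hy]
    exact fun s ψ => le_rfl

/-- Left adjoints with codomain `Φ X` are unique. -/
theorem isLeftAdjoint_unique {f f' : Functor 𝕋 Y (Φ.obj X)} {g : Functor 𝕋 (Φ.obj X) Y}
    (h : f.IsLeftAdjoint g) (h' : f'.IsLeftAdjoint g) : f = f' := by
  have aux : ∀ {f f' : Functor 𝕋 Y (Φ.obj X)}, f.IsLeftAdjoint g → f'.IsLeftAdjoint g →
      ∀ y, val (f.toFun y) ≤ val (f'.toFun y) := by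
    intro f f' h h' y
    rw [← str_le_str_iff]
    intro p
    -- `f y ≤ f (g (f' y)) ≤ f' y`: the unit of `f'`, then the counit of `f`.
    exact (f.str_mono ((Functor.le_iff _ _).1 h'.1 y) p).trans
      ((Functor.le_iff _ _).1 h.2 (f'.toFun y) p)
  ext1
  funext y
  exact val_injective (le_antisymm (aux h h' y) (aux h' h y))

/-! ### Cocompleteness -/

variable (Φ X) in
theorem cocomplete_obj : Φ.Cocomplete (Φ.obj X) := by
  intro Y Z φ h hφ
  -- `η` is the distributor `h^* ∘ (y_X)_*` whose fibres are the presheaves `h y`; the colimit has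
  -- fibres those of `φ ∘ η`.
  set η : 𝕋.TRel X.carrier Y.carrier := fun s y => val (h.toFun y) s with hη
  have hdist := Functor.isDistributor_lower (Φ.yoneda X)
  have hη' : 𝕋.comp h.upper (Φ.yoneda X).lower = η := by
    rw [h.upper_comp hdist, yoneda_lower]
  have hmem : ∀ z, Φ.mem X 𝕋.point (fun s _ => 𝕋.comp φ η s z) := by
    intro z
    -- Closure applied to `((z^* ∘ φ) ∘ h^*) ∘ (y_X)_*`, the last factor by density.
    have h1 := Φ.comp_lower_mem (Φ.yoneda X)
      (Φ.comp_upper_mem h (Φ.upper_comp_mem (Z.elem z) hφ)) (Φ.dense_yoneda X)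
    rw [comp_assoc, hη', Functor.upper_comp _ (Φ.isDistributor hφ)] at h1
    exact h1
  have hle : ∀ (t : 𝕋.T Z.carrier) (ψ : (Φ.obj X).carrier) (v : V),
      v ≤ (Φ.obj X).str (𝕋.map (fun z => ofMem _ (hmem z)) t) ψ ↔
        ∀ s, v * 𝕋.lift (𝕋.comp φ η) s t ≤ val ψ s :=
    fun t ψ v => le_str_iff (fun z => ofMem _ (hmem z)) t ψ v
  refine ⟨⟨fun z => ofMem _ (hmem z), fun t z => ?_⟩, ?_⟩
  · refine (hle _ _ _).2 fun s => ?_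
    rw [mul_comm]
    refine (𝕋.le_comp Z.str (𝕋.comp φ η) s t z).trans ?_
    -- Functoriality in `z` reduces to `c ∘ φ ≤ φ`, with `c` the structure of `Z`.
    rw [← comp_assoc]
    exact 𝕋.comp_mono (Φ.isDistributor hφ).comp_right le_rfl s z
  · funext t ψ
    -- Both sides have the same lower bounds `v`: each condition says that `v ⊗ lift η s u ⊗ lift φ
    -- u t ≤ ψ s` for all `s` and `u`, up to the order of quantifiers and factors.
    refine eq_of_forall_le_iff fun v => ?_
    refine (hle t ψ v).trans ?_
    have hlow : ∀ (u : 𝕋.T Y.carrier) (w : V),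
        w ≤ h.lower u ψ ↔ ∀ s, w * 𝕋.lift η s u ≤ val ψ s :=
      fun u w => le_str_iff h.toFun u ψ w
    simp only [extension, le_iInf_iff, Quantale.leftMulResiduation_le_iff_mul_le, hlow,
      lift_comp, mul_iSup_sort, iSup_le_iff]
    rw [forall_comm]
    simp only [mul_assoc, mul_comm (𝕋.lift η _ _)]

end DistributorClass

end TopologicalTheory

end TopTh

theorem mainTheorem5 {V : Type u} [CommMonoid V] [CompleteLattice V] [IsQuantale V]
    (𝕋 : TopTh.TopologicalTheory V) (Φ : 𝕋.DistributorClass) (X : 𝕋.Cat) :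
    Φ.Cocomplete (Φ.obj X) ∧
    ∃ hy : Φ.Dense (Φ.yoneda X),
      (∀ S : 𝕋.Functor (Φ.obj (Φ.obj X)) (Φ.obj X),
        S.IsLeftAdjoint (Φ.yoneda (Φ.obj X)) ↔ S = Φ.inverse (Φ.yoneda X) hy) ∧
      (Φ.inverse (Φ.yoneda X) hy).comp (Φ.yoneda (Φ.obj X))
        = TopTh.TopologicalTheory.Functor.id (Φ.obj X) ∧
      (Φ.map (Φ.yoneda X)).IsLeftAdjoint (Φ.inverse (Φ.yoneda X) hy) ∧
      (Φ.inverse (Φ.yoneda X) hy).IsLeftAdjoint (Φ.yoneda (Φ.obj X)) := by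
  have hy := Φ.dense_yoneda X
  have hadj := TopTh.TopologicalTheory.DistributorClass.inverse_yoneda_isLeftAdjoint hy
  refine ⟨Φ.cocomplete_obj X, hy, fun S => ⟨fun hS => ?_, ?_⟩, ?_, ?_, hadj⟩
  · exact TopTh.TopologicalTheory.DistributorClass.isLeftAdjoint_unique hS hadj
  · rintro rfl
    exact hadj
  · exact TopTh.TopologicalTheory.DistributorClass.inverse_yoneda_comp_yoneda hy
  · exact TopTh.TopologicalTheory.DistributorClass.map_isLeftAdjoint_inverse _ hy
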